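/- A bipartite graph $G=(U\sqcup V,E)$ has an ordered pair of finite parts, the left part $U$ and the right part $V$, and $E\subseteq U\times V$. We say that $G$ contains a copy of a bipartite graph $H=(A\sqcup B,F)$ if there are injections $f:A\to U$ and $g:B\to V$ with $(f(a),g(b))\in E$ for every $(a,b)\in F$. For $\sigma\in\mathbb{R}$ let $P_H(\sigma)$ be the following property: for every $\epsilon>0$ there exists $\delta>0$ such that every bipartite graph $G=(U\sqcup V,E)$ with $V\neq\emptyset$, $|V|\ge\epsilon|U|^{\sigma}$ and $|E|\ge\delta|V|$ contains a copy of $H$. The linear threshold of $H$ is the infimum, in $[-\infty,+\infty]$, of the set of all real $\sigma$ satisfying $P_H(\sigma)$. For integers $s,t\ge 1$ the complete bipartite subdivision $K'_{s,t}$ is the bipartite graph with left part $\{u_1,\dots,u_s\}\sqcup\{v_1,\dots,v_t\}$, right part $\{w_{ij}:1\le i\le s,\ 1\le j\le t\}$ and edges $u_iw_{ij}$, $v_jw_{ij}$ for all $i,j$. **Theorem.** Let $s\ge 1$ be an integer and $\sigma_s=2-1/s$. 1. For every integer $t\ge 1$, the number $\sigma_s$ itself has the property $P_{K'_{s,t}}(\sigma_s)$;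 in particular the linear threshold of $K'_{s,t}$ is at most $\sigma_s$. 2. For every real $\sigma<\sigma_s$ there exists an integer $T=T(s,\sigma)$ such that for every integer $t\ge T$ the linear threshold of $K'_{s,t}$ is strictly greater than $\sigma$. -/

import Mathlib

/-- A bipartite graph with left part `U` and right part `V`; the two parts are ordered. -/
structure BipartiteGraph (U V : Type*) where
  /-- Adjacency between a left vertex and a right vertex. -/
  Adj : U → V → Prop

namespace BipartiteGraph

/-- The edge set, as a set of pairs (left endpoint, right endpoint). -/
def edgeSet {U V : Type*} (G : BipartiteGraph U V) : Set (U × V) :=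
  {e | G.Adj e.1 e.2}

/-- `G` contains a copy of `H`, the left part of `H` sitting in the left part of `G` and the right
part of `H` in the right part of `G`. The copy need not be induced. -/
def ContainsCopy {U V A B : Type*} (G : BipartiteGraph U V) (H : BipartiteGraph A B) : Prop :=
  ∃ (f : A ↪ U) (g : B ↪ V), ∀ a b, H.Adj a b → G.Adj (f a) (g b)

/-- The condition on a real number `σ` that defines linear thresholds: for every `ε > 0` there is
`δ > 0` such that every finite bipartite graph with `|V| ≥ ε|U|^σ` and `|E| ≥ δ|V|` contains a copy
of `H`. The right part `V` is required to be nonempty, to exclude the graph without vertices. -/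
def IsLinearExponent {A B : Type*} (H : BipartiteGraph A B) (σ : ℝ) : Prop :=
  ∀ ε : ℝ, 0 < ε → ∃ δ : ℝ, 0 < δ ∧
    ∀ (U V : Type) [Fintype U] [Fintype V] [Nonempty V] (G : BipartiteGraph U V),
      ε * (Fintype.card U : ℝ) ^ σ ≤ (Fintype.card V : ℝ) →
      δ * (Fintype.card V : ℝ) ≤ (G.edgeSet.ncard : ℝ) →
      G.ContainsCopy H

/-- The linear threshold of `H`, as the infimum of the real numbers `σ` with the defining property.
It is taken in the extended reals: it is `⊥` if every real number has the property (as happens for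
a path of length two) and `⊤` if none has it. -/
noncomputable def linearThreshold {A B : Type*} (H : BipartiteGraph A B) : EReal :=
  sInf ((fun σ : ℝ => (σ : EReal)) '' {σ : ℝ | H.IsLinearExponent σ})

/-- The complete bipartite subdivision `K'_{s,t}`: the left part consists of the vertices `u_i`
(`Sum.inl i`) and `v_j` (`Sum.inr j`) of `K_{s,t}`, the right part of the subdivision vertices
`w_{ij}` (the pair `(i, j)`), and `w_{ij}` is adjacent exactly to `u_i` and `v_j`. -/
def completeSubdivision (s t : ℕ) : BipartiteGraph (Fin s ⊕ Fin t) (Fin s × Fin t) where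
  Adj x w := x = Sum.inl w.1 ∨ x = Sum.inr w.2

end BipartiteGraph

/-!
The exponent `σ = 2 - 1 / s` is the Turán exponent of `K_{s,t}`, and the theorem says that linearly
many edges with a large constant behave like a dense ordinary graph on the left part `U`.

*The exponent `2 - 1 / s` works.* Call two left vertices a light pair if they have fewer than `s * t`
common neighbours. In a graph `G` without a copy of `K'_{s,t}`, any `s + t` left vertices contain a
light pair (`exists_isLight`), since otherwise subdivision vertices can be chosen for all pairs among
them. Hence the neighbourhood of each right vertex `v` has a matching of light pairs that misses at
most `s + t` vertices (`exists_matching`). Give the pairs of this matching the colour `v`. A light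
pair gets few colours, so keeping one colour for each pair leaves at least `C |U| ^ (2 - 1 / s)`
pairs, where `C` is as large as desired if the average degree of the right vertices is. Each colour
class is a matching, so this graph on `U` is properly coloured, and a rainbow `K_{s,t}` in it is a
copy of `K'_{s,t}` in `G`. To find it (`exists_rainbow`), the Kővári–Sós–Turán count gives `s`
vertices with `t * s ^ 2` common neighbours; each of these has colour conflicts with at most `s ^ 2`
of them, so `t` without conflicts can be chosen greedily.

*No smaller exponent works for large `t`.* Take `d` classes of `n` left vertices, and let each of
about `2 (d * n) ^ σ` right vertices choose one neighbour in each class at random. The expected number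
of copies of `K'_{s,t}` is at most a constant times `n ^ (s + t + (σ - 2) * s * t)`
(`exists_card_copies_mul_le`). For `0 < σ < 2 - 1 / s` and `t` large this is bounded, so for large `n`
deleting one right vertex from each copy removes at most half of them
(`exists_not_containsCopy`), and the degree `d` of the remaining ones is arbitrary.
-/

namespace BipartiteGraph

open Finset

/-! ### Finding a copy -/

theorem exists_injective_choice {ι α : Type*} [Fintype ι] (A : ι → Finset α)
    (hA : ∀ i, Fintype.card ι ≤ #(A i)) :
    ∃ c : ι → α, Function.Injective c ∧ ∀ i, c i ∈ A i := by
  classical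
  refine (Finset.all_card_le_biUnion_card_iff_exists_injective A).1 fun I => ?_
  rcases I.eq_empty_or_nonempty with rfl | ⟨i, hi⟩
  · simp
  · exact (card_le_univ I).trans ((hA i).trans (card_le_card (subset_biUnion_of_mem A hi)))

theorem containsCopy_completeSubdivision {U V : Type*} (G : BipartiteGraph U V) {s t : ℕ}
    (u : Fin s → U) (g : Fin t → U) (c : Fin s × Fin t → V)
    (hu : Function.Injective u) (hg : Function.Injective g) (hc : Function.Injective c)
    (hne : ∀ i j, u i ≠ g j) (hl : ∀ i j, G.Adj (u i) (c (i, j)))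
    (hr : ∀ i j, G.Adj (g j) (c (i, j))) :
    G.ContainsCopy (completeSubdivision s t) := by
  refine ⟨⟨Sum.elim u g, hu.sumElim hg hne⟩, ⟨c, hc⟩, ?_⟩
  rintro a ⟨i, j⟩ (rfl | rfl)
  · exact hl i j
  · exact hr i j

/-! ### Matchings of pairs with few common neighbours -/

/-- Two distinct left vertices form a light pair if they have fewer than `k` common neighbours. -/
def IsLight {U V : Type*} (G : BipartiteGraph U V) (k : ℕ) (x y : U) : Prop :=
  x ≠ y ∧ {v | G.Adj x v ∧ G.Adj y v}.ncard < k

theorem IsLight.symm {U V : Type*} {G : BipartiteGraph U V} {k : ℕ} {x y : U}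
    (h : G.IsLight k x y) : G.IsLight k y x := by
  refine ⟨h.1.symm, ?_⟩
  simpa only [and_comm] using h.2

/-- Among any `s + t` left vertices of a graph without a copy of `K'_{s,t}` there is a light pair:
otherwise the subdivision vertices can be chosen one after the other. -/
theorem exists_isLight {U V : Type*} [Fintype V] (G : BipartiteGraph U V) {s t : ℕ}
    (hG : ¬ G.ContainsCopy (completeSubdivision s t)) (S : Finset U) (hS : s + t ≤ #S) :
    ∃ x ∈ S, ∃ y ∈ S, G.IsLight (s * t) x y := by
  classical
  by_contra! hno
  obtain ⟨e⟩ : Nonempty (Fin s ⊕ Fin t ↪ S) :=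
    Function.Embedding.nonempty_of_card_le (by simpa using hS)
  let a : Fin s ⊕ Fin t → U := fun i => e i
  have ha : Function.Injective a := Subtype.val_injective.comp e.injective
  obtain ⟨c, hc, hcm⟩ := exists_injective_choice
    (fun w : Fin s × Fin t => univ.filter fun v => G.Adj (a (.inl w.1)) v ∧ G.Adj (a (.inr w.2)) v)
    (fun w => by
      have h := hno (a (.inl w.1)) (e _).2 (a (.inr w.2)) (e _).2
      rw [IsLight, not_and, not_lt] at h
      have h' := h (ha.ne (by simp))
      rw [Set.ncard_eq_toFinset_card'] at h'
      simpa using h')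
  refine hG (containsCopy_completeSubdivision G (a ∘ Sum.inl) (a ∘ Sum.inr) c
    (ha.comp Sum.inl_injective) (ha.comp Sum.inr_injective) hc (fun i j => ha.ne (by simp))
    (fun i j => ?_) (fun i j => ?_))
  · exact (mem_filter.1 (hcm (i, j))).2.1
  · exact (mem_filter.1 (hcm (i, j))).2.2

/-- If every `r` elements of `S` contain a pair related by `R`, then a greedily chosen matching of
such pairs covers all but at most `r` elements of `S`. The matching is encoded as a symmetric set of
ordered pairs, so its cardinality is the number of vertices covered. -/
theorem exists_matching {U : Type*} [DecidableEq U] {R : U → U → Prop}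
    (hsymm : ∀ x y, R x y → R y x) (hirr : ∀ x y, R x y → x ≠ y) {r : ℕ} (S : Finset U)
    (hS : ∀ S' ⊆ S, r ≤ #S' → ∃ x ∈ S', ∃ y ∈ S', R x y) :
    ∃ P : Finset (U × U), (∀ x y, (x, y) ∈ P → x ∈ S ∧ y ∈ S ∧ R x y) ∧
      (∀ x y, (x, y) ∈ P → (y, x) ∈ P) ∧
      (∀ x y y', (x, y) ∈ P → (x, y') ∈ P → y = y') ∧ #S ≤ #P + r := by
  induction S using Finset.strongInduction with
  | H S ih =>
    by_cases hr : #S ≤ r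
    · exact ⟨∅, by simp, by simp, by simp, by simpa using hr⟩
    obtain ⟨x, hx, y, hy, hxy⟩ := hS S subset_rfl (by omega)
    have hne := hirr x y hxy
    have hsub : (S.erase x).erase y ⊆ S := (erase_subset _ _).trans (erase_subset _ _)
    have hcard : #((S.erase x).erase y) + 2 = #S := by
      rw [card_erase_of_mem (mem_erase.2 ⟨hne.symm, hy⟩), card_erase_of_mem hx]
      have : 1 < #S := one_lt_card.2 ⟨x, hx, y, hy, hne⟩
      omega
    obtain ⟨P, hP, hPs, hPm, hPc⟩ := ih ((S.erase x).erase y)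
      ((erase_subset _ _).trans_ssubset (erase_ssubset hx)) fun S' h => hS S' (h.trans hsub)
    have hmem : ∀ a b, (a, b) ∈ P → (a ∈ S ∧ b ∈ S ∧ R a b) ∧ a ≠ x ∧ a ≠ y := by
      intro a b hab
      obtain ⟨h1, h2, h3⟩ := hP a b hab
      have h4 := mem_erase.1 h1
      exact ⟨⟨hsub h1, hsub h2, h3⟩, (mem_erase.1 h4.2).1, h4.1⟩
    refine ⟨insert (x, y) (insert (y, x) P), ?_, ?_, ?_, ?_⟩
    · intro a b hab
      simp only [mem_insert, Prod.mk.injEq] at hab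
      rcases hab with ⟨rfl, rfl⟩ | ⟨rfl, rfl⟩ | hab
      · exact ⟨hx, hy, hxy⟩
      · exact ⟨hy, hx, hsymm _ _ hxy⟩
      · exact (hmem a b hab).1
    · intro a b hab
      simp only [mem_insert, Prod.mk.injEq] at hab ⊢
      rcases hab with ⟨rfl, rfl⟩ | ⟨rfl, rfl⟩ | hab
      · simp
      · simp
      · exact .inr (.inr (hPs a b hab))
    · intro a b b' hab hab'
      simp only [mem_insert, Prod.mk.injEq] at hab hab'
      have h := hmem a b
      have h' := hmem a b'
      have := hPm a b b'
      grind
    · rw [card_insert_of_notMem, card_insert_of_notMem]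
      · omega
      · exact fun h => (hmem _ _ h).2.2 rfl
      · simp only [mem_insert, Prod.mk.injEq, not_or]
        exact ⟨fun h => hne h.1, fun h => (hmem _ _ h).2.1 rfl⟩

/-! ### Rainbow complete bipartite graphs in properly coloured graphs -/

theorem exists_pairwise_notMem {U : Type*} [DecidableEq U] (F : U → Finset U) {k : ℕ}
    (hk : 0 < k) (hsymm : ∀ x y, x ∈ F y → y ∈ F x) (hF : ∀ x, #(F x) ≤ k)
    (X : Finset U) (t : ℕ) (hX : t * k ≤ #X) :
    ∃ g : Fin t → U, (∀ j, g j ∈ X) ∧ ∀ j j', j ≠ j' → g j ∉ F (g j') := by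
  induction t with
  | zero => exact ⟨Fin.elim0, fun j => j.elim0, fun j => j.elim0⟩
  | succ t ih =>
    rw [add_mul, one_mul] at hX
    obtain ⟨g, hgX, hg⟩ := ih (by omega)
    have hcard : #(univ.biUnion fun j => F (g j)) ≤ t * k := by
      simpa using card_biUnion_le_card_mul univ (fun j => F (g j)) k fun j _ => hF _
    obtain ⟨x, hxX, hx⟩ := exists_mem_notMem_of_card_lt_card (hcard.trans_lt (by omega : _ < #X))
    have hx' : ∀ j, x ∉ F (g j) := by simpa using hx
    refine ⟨Fin.cons x g, fun j => ?_, fun j j' => ?_⟩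
    · cases j using Fin.cases with
      | zero => exact hxX
      | succ j => exact hgX j
    · cases j using Fin.cases with
      | zero =>
        cases j' using Fin.cases with
        | zero => simp
        | succ j' => exact fun _ => hx' j'
      | succ j =>
        cases j' using Fin.cases with
        | zero => exact fun _ h => hx' j (hsymm _ _ h)
        | succ j' => exact fun h => hg j j' fun h' => h (congrArg Fin.succ h')

theorem descFactorial_card_le_card_embedding {U : Type*} [Fintype U] [DecidableEq U]
    (S : Finset U) (s : ℕ) :
    (#S).descFactorial s ≤ #(univ.filter fun u : Fin s ↪ U => ∀ i, u i ∈ S) := by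
  have h : Fintype.card (Fin s ↪ S) = (#S).descFactorial s := by
    simp [Fintype.card_embedding_eq]
  rw [← h, ← card_univ]
  refine card_le_card_of_injOn (fun u => u.trans (Function.Embedding.subtype _)) ?_ ?_
  · intro u _
    simp
  · intro u _ u' _ huu'
    ext i
    exact congrArg (fun w : Fin s ↪ U => w i) huu'

/-- The Kővári–Sós–Turán count: a bipartite relation on `U` with at least `2 K |U| ^ (2 - 1 / s)`
pairs has an `s`-tuple of distinct elements with at least `K` common neighbours. -/
theorem exists_embedding_card_common {U : Type*} [Fintype U] [DecidableEq U]
    (E : Finset (U × U)) {s K : ℕ} (hs : 1 ≤ s) (hK : s ≤ K) (hU : 0 < Fintype.card U)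
    (hE : 2 * (K : ℝ) * (Fintype.card U : ℝ) ^ (2 - 1 / (s : ℝ)) ≤ #E) :
    ∃ u : Fin s ↪ U, K ≤ #(univ.filter fun x => ∀ i, (x, u i) ∈ E) := by
  set N := Fintype.card U with hN
  set nb : U → Finset U := fun x => univ.filter fun y => (x, y) ∈ E with hnb
  have hN1 : (1 : ℝ) ≤ N := by exact_mod_cast hU
  have hs0 : (0 : ℝ) < s := by exact_mod_cast hs
  have hsum : ∑ x, #(nb x) = #E := by
    rw [card_eq_sum_card_fiberwise (f := Prod.fst) (t := univ) (by simp)]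
    refine sum_congr rfl fun x _ => ?_
    refine card_bij (fun y _ => (x, y)) (by simp [hnb]) (by simp) ?_
    rintro ⟨a, b⟩ h
    simp only [mem_filter] at h
    obtain ⟨h, rfl⟩ := h
    exact ⟨b, by simpa [hnb] using h, rfl⟩
  -- Each degree is lowered by `s - 1`, so that the falling factorial is at least a power.
  have hdeg : (K : ℝ) * (N : ℝ) ^ (2 - 1 / (s : ℝ)) ≤ ∑ x, ((#(nb x) + 1 - s : ℕ) : ℝ) := by
    have h1 : #E ≤ ∑ x, (#(nb x) + 1 - s) + s * N := by
      rw [← hsum, hN, ← card_univ, mul_comm s, ← smul_eq_mul, ← sum_const, ← sum_add_distrib]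
      exact sum_le_sum fun x _ => by omega
    have h2 : (#E : ℝ) ≤ ∑ x, ((#(nb x) + 1 - s : ℕ) : ℝ) + s * N := by exact_mod_cast h1
    have h3 : (N : ℝ) ≤ (N : ℝ) ^ (2 - 1 / (s : ℝ)) := by
      refine Real.self_le_rpow_of_one_le hN1 ?_
      have : 1 / (s : ℝ) ≤ 1 := by
        rw [div_le_one hs0]
        exact_mod_cast hs
      linarith
    have h4 : (s : ℝ) * N ≤ K * (N : ℝ) ^ (2 - 1 / (s : ℝ)) := by gcongr
    linarith
  have hmean : (K : ℝ) * (N : ℝ) ^ s ≤ ∑ x, ((#(nb x) + 1 - s : ℕ) : ℝ) ^ s := by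
    obtain ⟨n, rfl⟩ : ∃ n, s = n + 1 := ⟨s - 1, by omega⟩
    have h1 := pow_sum_le_card_mul_sum_pow (s := univ)
      (f := fun x => ((#(nb x) + 1 - (n + 1) : ℕ) : ℝ)) (fun x _ => Nat.cast_nonneg _) n
    rw [card_univ, ← hN] at h1
    have hN0 : (0 : ℝ) < N := by linarith
    have h2 : ((N : ℝ) ^ (2 - 1 / ((n + 1 : ℕ) : ℝ))) ^ (n + 1) = (N : ℝ) ^ n * N ^ (n + 1) := by
      rw [← Real.rpow_mul_natCast hN0.le, ← pow_add, ← Real.rpow_natCast]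
      congr 1
      push_cast
      field_simp
      ring
    have h3 : (K : ℝ) ≤ (K : ℝ) ^ (n + 1) :=
      le_self_pow₀ (by exact_mod_cast hs.trans hK) (by omega)
    refine le_of_mul_le_mul_left ?_ (pow_pos hN0 n)
    calc (N : ℝ) ^ n * (K * N ^ (n + 1)) = K * (N ^ n * N ^ (n + 1)) := by ring
      _ ≤ K ^ (n + 1) * (N ^ n * N ^ (n + 1)) := by gcongr
      _ = (K * (N : ℝ) ^ (2 - 1 / ((n + 1 : ℕ) : ℝ))) ^ (n + 1) := by rw [mul_pow, h2]
      _ ≤ (∑ x, ((#(nb x) + 1 - (n + 1) : ℕ) : ℝ)) ^ (n + 1) := by gcongr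
      _ ≤ _ := h1
  have hcount : (K : ℝ) * (N : ℝ) ^ s ≤
      ∑ u : Fin s ↪ U, (#(univ.filter fun x => ∀ i, (x, u i) ∈ E) : ℝ) := by
    refine hmean.trans ?_
    have h1 : ∑ x, (#(nb x) + 1 - s) ^ s ≤
        ∑ u : Fin s ↪ U, #(univ.filter fun x => ∀ i, (x, u i) ∈ E) := by
      have h2 := sum_card_bipartiteAbove_eq_sum_card_bipartiteBelow
        (fun (x : U) (u : Fin s ↪ U) => ∀ i, (x, u i) ∈ E) (s := univ) (t := univ)
      simp only [bipartiteAbove, bipartiteBelow] at h2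
      rw [← h2]
      refine sum_le_sum fun x _ => (Nat.pow_sub_le_descFactorial _ _).trans ?_
      simpa [hnb] using descFactorial_card_le_card_embedding (nb x) s
    exact_mod_cast h1
  by_contra! hlt
  have hKpos : (0 : ℝ) < K * (N : ℝ) ^ s := by
    have : (0 : ℝ) < K := by exact_mod_cast hs.trans hK
    positivity
  have hemb : Fintype.card (Fin s ↪ U) ≤ N ^ s := by
    rw [Fintype.card_embedding_eq, Fintype.card_fin]
    exact Nat.descFactorial_le_pow _ _
  have h1 : ∑ u : Fin s ↪ U, (#(univ.filter fun x => ∀ i, (x, u i) ∈ E) : ℝ)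
      < K * (N : ℝ) ^ s := by
    rcases isEmpty_or_nonempty (Fin s ↪ U) with h | h
    · simpa using hKpos
    · calc _ < ∑ u : Fin s ↪ U, (K : ℝ) :=
            sum_lt_sum_of_nonempty univ_nonempty fun u _ => by exact_mod_cast hlt u
        _ = K * Fintype.card (Fin s ↪ U) := by simp [mul_comm]
        _ ≤ _ := by gcongr; exact_mod_cast hemb
  linarith

/-- A properly coloured graph dense enough for the Kővári–Sós–Turán count contains a rainbow
`K_{s,t}`. The graph is given as a set of ordered pairs; the hypotheses on the colouring `c` say
that two pairs of the same colour share neither their first nor their second entry. -/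
theorem exists_rainbow {U V : Type*} [Fintype U] [DecidableEq U] [DecidableEq V]
    (E : Finset (U × U)) (c : U → U → V)
    (hrow : ∀ x y y', (x, y) ∈ E → (x, y') ∈ E → c x y = c x y' → y = y')
    (hcol : ∀ x x' y, (x, y) ∈ E → (x', y) ∈ E → c x y = c x' y → x = x')
    {s t : ℕ} (hs : 1 ≤ s) (ht : 1 ≤ t) (hU : 0 < Fintype.card U)
    (hE : 2 * ((t * (s * s) : ℕ) : ℝ) * (Fintype.card U : ℝ) ^ (2 - 1 / (s : ℝ)) ≤ #E) :
    ∃ (u : Fin s → U) (g : Fin t → U), Function.Injective u ∧ Function.Injective g ∧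
      (∀ i j, (g j, u i) ∈ E) ∧ Function.Injective fun w : Fin s × Fin t => c (g w.2) (u w.1) := by
  have hK : s ≤ t * (s * s) := by nlinarith [Nat.mul_le_mul ht (Nat.mul_le_mul hs (le_refl s))]
  obtain ⟨u, hu⟩ := exists_embedding_card_common E hs hK hU hE
  -- Two common neighbours conflict if edges from them to the tuple share a colour. As the colouring
  -- is proper, an edge at `x` and a tuple entry determine at most one conflicting vertex.
  set X := univ.filter fun x => ∀ i, (x, u i) ∈ E with hX
  let F : U → Finset U := fun x => univ.biUnion fun p : Fin s × Fin s =>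
    univ.filter fun x' => (x' ∈ X) ∧ x ∈ X ∧ c x (u p.1) = c x' (u p.2)
  have hmemF : ∀ x x', x' ∈ F x ↔ x' ∈ X ∧ x ∈ X ∧ ∃ i i', c x (u i) = c x' (u i') := by
    intro x x'
    simp [F]
  obtain ⟨g, hgX, hg⟩ := exists_pairwise_notMem F (Nat.mul_pos hs hs) (fun x y h => by
      rw [hmemF] at h ⊢
      obtain ⟨h1, h2, i, i', h⟩ := h
      exact ⟨h2, h1, i', i, h.symm⟩) (fun x => by
      have := card_biUnion_le_card_mul univ (fun p : Fin s × Fin s =>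
        univ.filter fun x' => (x' ∈ X) ∧ x ∈ X ∧ c x (u p.1) = c x' (u p.2)) 1 (fun p _ => by
          refine card_le_one.2 fun a ha b hb => ?_
          simp only [hX, mem_filter, mem_univ, true_and] at ha hb
          exact hcol a b (u p.2) (ha.1 _) (hb.1 _) (ha.2.2.symm.trans hb.2.2))
      simpa using this) X t hu
  have hgE : ∀ i j, (g j, u i) ∈ E := fun i j => (mem_filter.1 (hgX j)).2 i
  have hcol' : ∀ i j i' j', c (g j) (u i) = c (g j') (u i') → j = j' := by
    intro i j i' j' h
    by_contra hne
    exact hg j j' hne ((hmemF _ _).2 ⟨hgX j, hgX j', i', i, h.symm⟩)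
  refine ⟨u, g, u.injective, fun j j' h => ?_, hgE, ?_⟩
  · exact hcol' ⟨0, hs⟩ j ⟨0, hs⟩ j' (by rw [h])
  · rintro ⟨i, j⟩ ⟨i', j'⟩ h
    obtain rfl := hcol' i j i' j' h
    exact Prod.ext (u.injective (hrow _ _ _ (hgE i j) (hgE i' j) h)) rfl

/-! ### The upper bound -/

theorem isLinearExponent_completeSubdivision {s t : ℕ} (hs : 1 ≤ s) (ht : 1 ≤ t) :
    (completeSubdivision s t).IsLinearExponent (2 - 1 / (s : ℝ)) := by
  classical
  intro ε hε
  set K := t * (s * s) with hK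
  have hst : (0 : ℝ) < (s * t : ℕ) := by exact_mod_cast Nat.mul_pos hs ht
  have hgap : (0 : ℝ) ≤ 2 * K * (s * t : ℕ) / ε := by positivity
  have hr : (0 : ℝ) < (s + t : ℕ) := by exact_mod_cast (by omega : 0 < s + t)
  refine ⟨(s + t : ℕ) + 2 * K * (s * t : ℕ) / ε, by linarith, ?_⟩
  intro U V _ _ _ G hV hE
  by_contra hG
  have hM : (0 : ℝ) < Fintype.card V := by exact_mod_cast Fintype.card_pos
  let nb : V → Finset U := fun v => univ.filter fun x => G.Adj x v
  have hsum : G.edgeSet.ncard = ∑ v, #(nb v) := by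
    rw [Set.ncard_eq_toFinset_card', card_eq_sum_card_fiberwise (f := Prod.snd) (t := univ)
      (by simp)]
    refine sum_congr rfl fun v _ => (card_bij (fun x _ => (x, v)) ?_ (by simp) ?_).symm
    · intro x hx
      rw [mem_filter, Set.mem_toFinset]
      exact ⟨(mem_filter.1 hx).2, rfl⟩
    · rintro ⟨a, b⟩ h
      rw [mem_filter, Set.mem_toFinset] at h
      obtain ⟨h, rfl⟩ := h
      exact ⟨a, mem_filter.2 ⟨mem_univ a, h⟩, rfl⟩
  have hU : 0 < Fintype.card U := by
    by_contra h0
    have : IsEmpty U := Fintype.card_eq_zero_iff.1 (by omega)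
    have h1 : G.edgeSet.ncard = 0 := by
      rw [hsum]
      exact sum_eq_zero fun v _ => card_eq_zero.2 (eq_empty_of_isEmpty _)
    rw [h1, Nat.cast_zero] at hE
    have : 0 < ((s + t : ℕ) + 2 * K * (s * t : ℕ) / ε) * (Fintype.card V : ℝ) := by positivity
    linarith
  choose P hP hPs hPm hPc using fun v => exists_matching (R := G.IsLight (s * t))
    (fun x y h => h.symm) (fun x y h => h.1) (r := s + t) (nb v)
    (fun S' _ h => G.exists_isLight hG S' h)
  -- A light pair is coloured by a vertex whose matching contains it.
  set E : Finset (U × U) := univ.biUnion P with hEdef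
  have hmemE : ∀ x y, (x, y) ∈ E → ∃ v, (x, y) ∈ P v := by
    intro x y h
    simpa [hEdef] using h
  let c : U → U → V := fun x y => Classical.epsilon fun v => (x, y) ∈ P v
  have hc : ∀ x y, (x, y) ∈ E → (x, y) ∈ P (c x y) := fun x y h =>
    Classical.epsilon_spec (hmemE x y h)
  -- A light pair lies in fewer than `s * t` of the matchings.
  have hEcard : ∑ v, #(P v) ≤ #E * (s * t) := by
    have h1 := sum_card_bipartiteAbove_eq_sum_card_bipartiteBelow
      (fun (v : V) (p : U × U) => p ∈ P v) (s := univ) (t := E)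
    simp only [bipartiteAbove, bipartiteBelow] at h1
    have h2 : ∀ v, E.filter (fun p => p ∈ P v) = P v := by
      intro v
      ext p
      simp only [mem_filter, and_iff_right_iff_imp]
      exact fun h => mem_biUnion.2 ⟨v, mem_univ v, h⟩
    simp only [h2] at h1
    rw [h1]
    refine sum_le_card_nsmul _ _ _ ?_
    rintro ⟨x, y⟩ hxy
    have hl := (hP _ x y (hc x y hxy)).2.2.2
    rw [Set.ncard_eq_toFinset_card'] at hl
    refine le_trans (card_le_card fun v hv => ?_) hl.le
    have h3 := hP v x y (mem_filter.1 hv).2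
    simpa [nb] using And.intro h3.1 h3.2.1
  have hdense : 2 * (K : ℝ) * (Fintype.card U : ℝ) ^ (2 - 1 / (s : ℝ)) ≤ #E := by
    have h1 : G.edgeSet.ncard ≤ #E * (s * t) + Fintype.card V * (s + t) := by
      calc _ ≤ ∑ v, (#(P v) + (s + t)) := hsum.trans_le (sum_le_sum fun v _ => hPc v)
        _ = ∑ v, #(P v) + Fintype.card V * (s + t) := by simp [sum_add_distrib]
        _ ≤ _ := by gcongr
    have h2 : (G.edgeSet.ncard : ℝ) ≤ #E * (s * t : ℕ) + Fintype.card V * (s + t : ℕ) := by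
      exact_mod_cast h1
    have h3 : 2 * K * (s * t : ℕ) / ε * (Fintype.card V : ℝ) ≤ #E * (s * t : ℕ) := by linarith
    have h4 : 2 * K * (s * t : ℕ) / ε * (ε * (Fintype.card U : ℝ) ^ (2 - 1 / (s : ℝ)))
        ≤ #E * (s * t : ℕ) := (mul_le_mul_of_nonneg_left hV hgap).trans h3
    refine le_of_mul_le_mul_right (le_trans (le_of_eq ?_) h4) hst
    field_simp
  obtain ⟨u, g, hu, hg, hgE, hinj⟩ := exists_rainbow E c
    (fun x y y' h h' hcc => hPm (c x y) x y y' (hc x y h) (hcc ▸ hc x y' h'))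
    (fun x x' y h h' hcc => hPm (c x y) y x x' (hPs _ _ _ (hc x y h))
      (hPs _ _ _ (hcc ▸ hc x' y h'))) hs ht hU hdense
  have hlight := fun i j => hP _ _ _ (hc _ _ (hgE i j))
  refine hG (containsCopy_completeSubdivision G u g _ hu hg hinj
    (fun i j => (hlight i j).2.2.1.symm) (fun i j => ?_) fun i j => ?_)
  · exact (mem_filter.1 (hlight i j).2.1).2
  · exact (mem_filter.1 (hlight i j).1).2

/-! ### Random graphs with few copies -/

/-- The bipartite graph in which the left part is split into `d` classes of size `n` and the right
vertex `v` is adjacent to exactly one vertex of each class, namely `h v p` in the class `p`. -/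
def choiceGraph {V : Type*} {d n : ℕ} (h : V → Fin d → Fin n) :
    BipartiteGraph (Fin d × Fin n) V where
  Adj x v := h v x.1 = x.2

/-- If each of the sets `S w` has density at most `1 / m` in `K`, then a random function into `K`
takes values in `S w` at the distinct points `g w`, for all `w`, with probability at most
`1 / m ^ |ι|`. -/
theorem card_forall_mem_mul_pow_le {ι V K : Type*} [Fintype ι] [Fintype V] [Fintype K]
    [DecidableEq V] [DecidableEq K] (g : ι ↪ V) (S : ι → Finset K) (m : ℕ)
    (hS : ∀ w, #(S w) * m ≤ Fintype.card K) :
    #(univ.filter fun h : V → K => ∀ w, h (g w) ∈ S w) * m ^ Fintype.card ι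
      ≤ Fintype.card (V → K) := by
  classical
  let T : V → Finset K := fun v => univ.filter fun k => ∀ w, g w = v → k ∈ S w
  have hT : (univ.filter fun h : V → K => ∀ w, h (g w) ∈ S w) = Fintype.piFinset T := by
    ext h
    simp only [T, mem_filter, mem_univ, true_and, Fintype.mem_piFinset]
    exact ⟨fun H v w hw => hw ▸ H w, fun H w => H _ w rfl⟩
  have hm : m ^ Fintype.card ι = ∏ v : V, if v ∈ univ.map g then m else 1 := by
    rw [← prod_filter, prod_const, filter_mem_eq_inter, univ_inter, card_map, card_univ]
  rw [hT, Fintype.card_piFinset, hm, ← prod_mul_distrib, Fintype.card_fun, ← card_univ (α := V),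
    ← prod_const]
  refine prod_le_prod' fun v _ => ?_
  split_ifs with hv
  · obtain ⟨w, -, rfl⟩ := mem_map.1 hv
    refine le_trans (Nat.mul_le_mul_right _ (card_le_card fun k hk => ?_)) (hS w)
    exact (mem_filter.1 hk).2 w rfl
  · simpa using card_le_univ (T v)

theorem card_two_values_mul_le {d n : ℕ} {p q : Fin d} (hpq : p ≠ q) (a b : Fin n) :
    #(univ.filter fun k : Fin d → Fin n => k p = a ∧ k q = b) * n ^ 2
      ≤ Fintype.card (Fin d → Fin n) := by
  have h : n ^ 2 = #(univ : Finset (Fin n × Fin n)) := by simp [sq]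
  rw [h, ← card_product, ← card_univ]
  refine card_le_card_of_injOn
    (fun z => Function.update (Function.update z.1 p z.2.1) q z.2.2) (by simp) ?_
  rintro ⟨k, x, y⟩ hk ⟨k', x', y'⟩ hk' heq
  simp only [coe_product, Set.mem_prod, mem_coe, mem_filter, mem_univ, true_and, and_true]
    at hk hk'
  have hval := fun i => congrFun heq i
  have hq := hval q
  have hp := hval p
  simp only [Function.update_self, Function.update_of_ne hpq] at hp hq
  have hkk : k = k' := by
    ext i
    have hi := hval i
    by_cases h1 : i = q
    · rw [h1, hk.2, hk'.2]
    · by_cases h2 : i = p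
      · rw [h2, hk.1, hk'.1]
      · simp only [Function.update_of_ne h1, Function.update_of_ne h2] at hi
        rw [hi]
  rw [hp, hq, hkk]

/-- The pairs of maps that form a copy of `K'_{s,t}` in the graph of `h`. -/
def copies {V : Type*} [Fintype V] {d n : ℕ} (s t : ℕ) (h : V → Fin d → Fin n) :
    Set ((Fin s ⊕ Fin t → Fin d × Fin n) × (Fin s × Fin t ↪ V)) :=
  {z | Function.Injective z.1 ∧
    ∀ a b, (completeSubdivision s t).Adj a b → (choiceGraph h).Adj (z.1 a) (z.2 b)}

/-- A fixed placement of `K'_{s,t}` is a copy in the graph of a random `h` with probability at most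
`n ^ (-2 s t)`. -/
theorem card_copy_mul_le {V : Type*} [Fintype V] [DecidableEq V] {d n s t : ℕ}
    (z : (Fin s ⊕ Fin t → Fin d × Fin n) × (Fin s × Fin t ↪ V)) :
    {h : V → Fin d → Fin n | z ∈ copies s t h}.ncard * (n ^ 2) ^ (s * t)
      ≤ Fintype.card (V → Fin d → Fin n) := by
  classical
  obtain ⟨f, g⟩ := z
  by_cases hf : Function.Injective f
  · have hst : s * t = Fintype.card (Fin s × Fin t) := by simp
    rw [hst]
    refine le_trans (Nat.mul_le_mul_right _ ?_) (card_forall_mem_mul_pow_le g (fun w =>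
      univ.filter fun k : Fin d → Fin n => f (.inl w.1) ≠ f (.inr w.2) ∧
        k (f (.inl w.1)).1 = (f (.inl w.1)).2 ∧ k (f (.inr w.2)).1 = (f (.inr w.2)).2) (n ^ 2)
      fun w => ?_)
    · rw [Set.ncard_eq_toFinset_card']
      refine card_le_card fun h hh => ?_
      rw [Set.mem_toFinset] at hh
      simp only [mem_filter, mem_univ, true_and]
      exact fun w => ⟨hf.ne (by simp), hh.2 _ w (.inl rfl), hh.2 _ w (.inr rfl)⟩
    · -- Two vertices of the same class have no common neighbour.
      by_cases hp : (f (.inl w.1)).1 = (f (.inr w.2)).1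
      · rw [filter_false_of_mem, card_empty, zero_mul]
        · exact Nat.zero_le _
        · rintro k - ⟨hne, h1, h2⟩
          exact hne (Prod.ext hp (by rw [← h1, ← h2, hp]))
      · refine le_trans (Nat.mul_le_mul_right _ (card_le_card fun k hk => ?_))
          (card_two_values_mul_le hp (f (.inl w.1)).2 (f (.inr w.2)).2)
        simp only [mem_filter, mem_univ, true_and] at hk ⊢
        exact hk.2
  · have : {h : V → Fin d → Fin n | (f, g) ∈ copies s t h} = ∅ :=
      Set.eq_empty_of_forall_notMem fun h hh => hf hh.1
    simp [this]

/-- The first moment bound: some graph has at most the expected number of copies. -/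
theorem exists_card_copies_mul_le (V : Type*) [Fintype V] {d n : ℕ} (hn : 0 < n) (s t : ℕ) :
    ∃ h : V → Fin d → Fin n, (copies s t h).ncard * (n ^ 2) ^ (s * t)
      ≤ (d * n) ^ (s + t) * Fintype.card V ^ (s * t) := by
  classical
  have : Nonempty (Fin n) := ⟨⟨0, hn⟩⟩
  set B := (d * n) ^ (s + t) * Fintype.card V ^ (s * t) with hB
  have hcard : Fintype.card ((Fin s ⊕ Fin t → Fin d × Fin n) × (Fin s × Fin t ↪ V)) ≤ B := by
    rw [Fintype.card_prod, Fintype.card_embedding_eq]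
    refine Nat.mul_le_mul (by simp) ?_
    simpa using Nat.descFactorial_le_pow (Fintype.card V) (s * t)
  have hdouble := sum_card_bipartiteAbove_eq_sum_card_bipartiteBelow
    (fun (h : V → Fin d → Fin n) z => z ∈ copies s t h) (s := univ) (t := univ)
  obtain ⟨h, -, hh⟩ := exists_le_of_sum_le (s := (univ : Finset (V → Fin d → Fin n)))
    (f := fun h => (copies s t h).ncard * (n ^ 2) ^ (s * t)) (g := fun _ => B) univ_nonempty (by
      rw [← sum_mul, sum_const, smul_eq_mul, card_univ]
      calc _ = ∑ z, {h : V → Fin d → Fin n | z ∈ copies s t h}.ncard * (n ^ 2) ^ (s * t) := by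
            rw [← sum_mul]
            congr 1
            convert hdouble using 2
            · rw [Set.ncard_eq_toFinset_card']
              congr 1
              ext
              simp [bipartiteAbove]
            · rw [Set.ncard_eq_toFinset_card']
              congr 1
              ext
              simp [bipartiteBelow]
        _ ≤ ∑ z : (Fin s ⊕ Fin t → Fin d × Fin n) × (Fin s × Fin t ↪ V),
            Fintype.card (V → Fin d → Fin n) := sum_le_sum fun z _ => card_copy_mul_le z
        _ ≤ _ := by
            rw [sum_const, smul_eq_mul, card_univ, mul_comm]
            gcongr)
  exact ⟨h, hh⟩

/-! ### Deleting the copies -/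

/-- Deleting one right vertex from each copy in the graph of `h` leaves a graph without copies in
which every right vertex still has degree `d`. -/
theorem exists_not_containsCopy {V : Type} [Fintype V] {d n s t : ℕ} (hs : 1 ≤ s) (ht : 1 ≤ t)
    (h : V → Fin d → Fin n) :
    ∃ W : Finset V, Fintype.card V ≤ #W + (copies s t h).ncard ∧
      ∃ G : BipartiteGraph (Fin d × Fin n) W, G.edgeSet.ncard = d * #W ∧
        ¬ G.ContainsCopy (completeSubdivision s t) := by
  classical
  let w₀ : Fin s × Fin t := (⟨0, hs⟩, ⟨0, ht⟩)
  let D : Finset V := (copies s t h).toFinset.image fun z => z.2 w₀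
  refine ⟨Dᶜ, ?_, choiceGraph fun v => h v, ?_, ?_⟩
  · rw [card_compl, Set.ncard_eq_toFinset_card']
    have : #D ≤ #(copies s t h).toFinset := card_image_le
    omega
  · have h1 : (choiceGraph fun v : (Dᶜ : Finset V) => h v).edgeSet =
        (fun z : Fin d × (Dᶜ : Finset V) => ((z.1, h z.2 z.1), z.2)) '' Set.univ := by
      ext ⟨⟨p, a⟩, v⟩
      constructor
      · intro hv
        exact ⟨(p, v), trivial, congrArg (fun b => ((p, b), v)) hv⟩
      · rintro ⟨⟨p', v'⟩, -, heq⟩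
        simp only [Prod.mk.injEq] at heq
        obtain ⟨⟨rfl, rfl⟩, rfl⟩ := heq
        rfl
    rw [h1, Set.ncard_image_of_injective, Set.ncard_univ, Nat.card_eq_fintype_card]
    · rw [Fintype.card_prod, Fintype.card_fin, Fintype.card_coe]
    · rintro ⟨p, v⟩ ⟨p', v'⟩ heq
      simp only [Prod.mk.injEq] at heq
      exact Prod.ext heq.1.1 heq.2
  · rintro ⟨f, g, hfg⟩
    refine mem_compl.1 (g w₀).2 (mem_image.2 ⟨(f, g.trans (Function.Embedding.subtype _)), ?_, rfl⟩)
    rw [Set.mem_toFinset]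
    exact ⟨f.injective, hfg⟩

/-! ### The lower bound -/

theorem not_isLinearExponent_completeSubdivision {s t : ℕ} (hs : 1 ≤ s) (ht : 1 ≤ t) {σ : ℝ}
    (hσ : 0 < σ) (hσst : (s + t : ℝ) + (σ - 2) * (s * t) ≤ 0) :
    ¬ (completeSubdivision s t).IsLinearExponent σ := by
  intro hlin
  obtain ⟨δ, -, H⟩ := hlin 1 one_pos
  obtain ⟨d, hd⟩ := exists_nat_ge (max δ 1)
  have hd1 : (1 : ℝ) ≤ d := (le_max_right _ _).trans hd
  -- Up to the factor on the left, the expected number of copies is bounded independently of `n`.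
  obtain ⟨n, hn, hn1⟩ : ∃ n : ℕ, (3 : ℝ) ^ (s * t) * ((d : ℝ) ^ 2) ^ (s * t) ≤ (n : ℝ) ^ σ ∧ 0 < n :=
    ((((tendsto_rpow_atTop hσ).comp tendsto_natCast_atTop_atTop).eventually_ge_atTop _).and
      (Filter.eventually_gt_atTop 0)).exists
  have hn1' : (1 : ℝ) ≤ n := by exact_mod_cast hn1
  set x : ℝ := d * n with hx
  have hx1 : 1 ≤ x := one_le_mul_of_one_le_of_one_le hd1 hn1'
  have hx0 : 0 < x := by linarith
  have hxσ : 1 ≤ x ^ σ := Real.one_le_rpow hx1 hσ.le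
  set M := ⌈2 * x ^ σ⌉₊ with hM
  have hM1 : 2 * x ^ σ ≤ M := Nat.le_ceil _
  have hM2 : (M : ℝ) ≤ 3 * x ^ σ := by
    have := Nat.ceil_lt_add_one (show 0 ≤ 2 * x ^ σ by positivity)
    linarith
  obtain ⟨h, hh⟩ := exists_card_copies_mul_le (Fin M) (d := d) hn1 s t
  obtain ⟨W, hW, G, hGE, hG⟩ := exists_not_containsCopy hs ht h
  rw [Fintype.card_fin] at hh hW
  have hcopies : ((copies s t h).ncard : ℝ) ≤ x ^ σ := by
    have h1 : ((copies s t h).ncard : ℝ) * ((n : ℝ) ^ 2) ^ (s * t)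
        ≤ x ^ (s + t) * (M : ℝ) ^ (s * t) := by
      rw [hx]
      exact_mod_cast hh
    have h2 : x ^ (s + t) * (x ^ σ) ^ (s * t) ≤ (x ^ 2) ^ (s * t) := by
      rw [← pow_mul, ← Real.rpow_mul_natCast hx0.le, ← Real.rpow_natCast, ← Real.rpow_natCast,
        ← Real.rpow_add hx0]
      refine Real.rpow_le_rpow_of_exponent_le hx1 ?_
      push_cast
      linarith
    have hn0 : (0 : ℝ) < ((n : ℝ) ^ 2) ^ (s * t) := by positivity
    refine le_of_mul_le_mul_right ?_ hn0
    calc _ ≤ x ^ (s + t) * (M : ℝ) ^ (s * t) := h1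
      _ ≤ x ^ (s + t) * (3 * x ^ σ) ^ (s * t) := by gcongr
      _ = 3 ^ (s * t) * (x ^ (s + t) * (x ^ σ) ^ (s * t)) := by rw [mul_pow]; ring
      _ ≤ 3 ^ (s * t) * (x ^ 2) ^ (s * t) := by gcongr
      _ = (3 ^ (s * t) * ((d : ℝ) ^ 2) ^ (s * t)) * ((n : ℝ) ^ 2) ^ (s * t) := by
          rw [hx, mul_pow, mul_pow, mul_assoc]
      _ ≤ x ^ σ * ((n : ℝ) ^ 2) ^ (s * t) := by
          refine mul_le_mul_of_nonneg_right (hn.trans ?_) hn0.le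
          exact Real.rpow_le_rpow (by linarith) (le_mul_of_one_le_left (by linarith) hd1) hσ.le
  have hWcard : x ^ σ ≤ #W := by
    have : (M : ℝ) ≤ #W + (copies s t h).ncard := by exact_mod_cast hW
    linarith
  have : Nonempty W := by
    have : (0 : ℝ) < #W := by linarith
    exact (card_pos.1 (by exact_mod_cast this)).to_subtype
  refine hG (H _ _ G ?_ ?_)
  · simpa [hx] using hWcard
  · rw [hGE, Fintype.card_coe]
    push_cast
    gcongr
    exact (le_max_left _ _).trans hd

/-- The linear exponents are upward closed, so a real number that is not one bounds the threshold
from below. -/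
theorem le_linearThreshold {A B : Type*} {H : BipartiteGraph A B} {σ : ℝ}
    (hσ : ¬ H.IsLinearExponent σ) : (σ : EReal) ≤ H.linearThreshold := by
  refine le_sInf ?_
  rintro _ ⟨τ, hτ, rfl⟩
  rw [EReal.coe_le_coe_iff]
  by_contra! hlt
  refine hσ fun ε hε => ?_
  obtain ⟨δ, hδ, Hδ⟩ := hτ ε hε
  refine ⟨δ, hδ, fun U V _ _ _ G hV hE => ?_⟩
  rcases isEmpty_or_nonempty U with hU | hU
  · have h0 : G.edgeSet = ∅ := Set.eq_empty_of_isEmpty _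
    have hM : (0 : ℝ) < Fintype.card V := by exact_mod_cast Fintype.card_pos
    rw [h0, Set.ncard_empty, Nat.cast_zero] at hE
    exact absurd hE (not_le.2 (mul_pos hδ hM))
  · refine Hδ U V G (le_trans ?_ hV) hE
    gcongr
    exact_mod_cast Fintype.card_pos

end BipartiteGraph

theorem theorem1p1 (s : ℕ) (hs : 1 ≤ s) :
    (∀ t : ℕ, 1 ≤ t →
      (BipartiteGraph.completeSubdivision s t).IsLinearExponent (2 - 1 / (s : ℝ)) ∧
      (BipartiteGraph.completeSubdivision s t).linearThreshold
        ≤ ((2 - 1 / (s : ℝ) : ℝ) : EReal)) ∧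
    (∀ σ : ℝ, σ < 2 - 1 / (s : ℝ) →
      ∃ T : ℕ, ∀ t : ℕ, T ≤ t →
        (σ : EReal) < (BipartiteGraph.completeSubdivision s t).linearThreshold) := by
  have hs1 : (1 : ℝ) ≤ s := by exact_mod_cast hs
  refine ⟨fun t ht => ?_, fun σ hσ => ?_⟩
  · have h := BipartiteGraph.isLinearExponent_completeSubdivision hs ht
    exact ⟨h, sInf_le ⟨_, h, rfl⟩⟩
  · have hpos : (0 : ℝ) < 2 - 1 / (s : ℝ) := by
      have : 1 / (s : ℝ) ≤ 1 := (div_le_one (by linarith)).2 hs1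
      linarith
    obtain ⟨τ, hτ, hτs⟩ := exists_between (max_lt hσ hpos)
    obtain ⟨T, hT⟩ := exists_nat_ge (max 1 (1 / (2 - 1 / (s : ℝ) - τ)))
    refine ⟨T, fun t ht => lt_of_lt_of_le (EReal.coe_lt_coe_iff.2 ((le_max_left _ _).trans_lt hτ))
      (BipartiteGraph.le_linearThreshold (BipartiteGraph.not_isLinearExponent_completeSubdivision
        hs ?_ ((le_max_right _ _).trans_lt hτ) ?_))⟩
    · exact le_trans (by exact_mod_cast (le_max_left _ _).trans hT) ht
    · -- The exponent equals `s * (1 - (2 - 1 / s - τ) * t)`.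
      have h1 : 1 ≤ (2 - 1 / (s : ℝ) - τ) * t := by
        rw [← div_le_iff₀' (by linarith)]
        exact ((le_max_right _ _).trans hT).trans (by exact_mod_cast ht)
      have h2 : (s + t : ℝ) + (τ - 2) * (s * t) = s * (1 - (2 - 1 / (s : ℝ) - τ) * t) := by
        field_simp
        ring
      rw [h2]
      exact mul_nonpos_of_nonneg_of_nonpos (by linarith) (by linarith)
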